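/- **Setting.** Let $n\in\mathbb N$, $K\in\mathbb N_+$, let $\mathcal P$ be an index set, $A_i\in\mathbb R^{n\times n}$ for $i\in\mathcal P$, and let $\underline a,\overline a>0$, $\mu\ge 1$. Write $\|\cdot\|$ for the Euclidean norm on $\mathbb R^n$ and $\|\cdot\|_\infty$ for the maximum norm. **Triangulation.** For $\mathbf z\in\mathbb N_0^n$, $\mathcal J\subset\{1,\dots,n\}$, a permutation $\rho$ of $\{1,\dots,n\}$ and $j=0,\dots,n$ put $\mathbf x_j^{\mathbf z\mathcal J\rho}=\mathbf R^{\mathcal J}(\mathbf z+\sum_{i=1}^j\mathbf e_{\rho(i)})$, where $\mathbf R^{\mathcal J}$ changes the sign of the coordinates with index in $\mathcal J$. Let $\mathbf F(\mathbf 0)=\mathbf 0$ and $\mathbf F(\mathbf x)=\frac{\|\mathbf x\|_\infty}{\|\mathbf x\|}\mathbf x$ for $\mathbf x\ne\mathbf 0$. The fan triangulation $\mathcal T_K^{\mathbf F}$ consists of the simplices $\mathfrak S_\nu=\operatorname{co}\{\mathbf 0,\mathbf x_1^\nu,\dots,\mathbf x_n^\nu\}$, $\mathbf x_j^\nu=\mathbf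 F(\mathbf x_j^{\mathbf z\mathcal J\rho})$, over all $\nu=(\mathbf z,\mathcal J,\rho)$ with $\|\mathbf x_0^{\mathbf z\mathcal J\rho}\|_\infty<K$ and $\|\mathbf x_j^{\mathbf z\mathcal J\rho}\|_\infty=K$ for $j=1,\dots,n$. Let $X_\nu=(\mathbf x_1^\nu\cdots\mathbf x_n^\nu)$ and $\operatorname{cone}\nu=\{\sum_j\lambda_j\mathbf x_j^\nu:\lambda_j\ge 0\}$. **Linear program.** Suppose that $\alpha>0$ and real numbers $V_{\mathbf x,i}$ ($\mathbf x$ a vertex of a simplex in $\mathcal T_K^{\mathbf F}$, $i\in\mathcal P$) satisfy $V_{\mathbf 0,i}=0$ and: 1. $\underline a\|\mathbf x\|\le V_{\mathbf x,i}\le\overline a\|\mathbf x\|$ for all vertices $\mathbf x$ and all $i\in\mathcal P$; 2. $\mathbf v_{\nu,i}^\top X_\nu^{-1}A_i\mathbf x_j^\nu\le-\alpha\|\mathbf x_j^\nu\|$ for all simplices $\mathfrak S_\nu$, all $j=1,\dots,n$ and all $i\in\mathcal P$, where $\mathbf v_{\nu,i}=(V_{\mathbf x_1^\nu,i},\dots,V_{\mathbf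 x_n^\nu,i})^\top$; 3. $V_{\mathbf x,j}\le\mu V_{\mathbf x,i}$ for all vertices $\mathbf x$ and all $i,j\in\mathcal P$. **Definitions.** Solutions are locally absolutely continuous curves on $[0,\infty)$ that satisfy the differential equation almost everywhere. $D^+V(\mathbf x,A_i\mathbf x)=\limsup_{h\to0+}\frac{V(\boldsymbol\phi(h))-V(\mathbf x)}{h}$, where $\boldsymbol\phi$ is the solution of $\dot{\boldsymbol\phi}=A_i\boldsymbol\phi$ with $\boldsymbol\phi(0)=\mathbf x$. A switching signal is a right-continuous, piecewise constant $\sigma:[0,\infty)\to\mathcal P$ whose discontinuities (the switches) are locally finite. It has average dwell-time $\tau_a$ with chatter bound $N_0>0$ if for all $0\le s\le t$ the number of switches in $(s,t)$ is at most $N_0+\frac{t-s}{\tau_a}$. **Conclusion.** The vertices $\mathbf x_1^\nu,\dots,\mathbf x_n^\nu$ of each simplex are linearly independent, the cones $\operatorname{cone}\nu$ cover $\mathbb R^n$, and there are unique functions $V_i:\mathbb R^n\to\mathbb R$, $i\in\mathcal P$, with $$V_i\Big(\sum_{j=1}^n\lambda_j\mathbf x_j^\nu\Big)=\sum_{j=1}^n\lambda_jV_{\mathbf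 x_j^\nu,i}\qquad\text{for all }\mathfrak S_\nu\in\mathcal T_K^{\mathbf F}\text{ and all }\lambda_1,\dots,\lambda_n\ge0 .$$ They are continuous and piecewise linear, with $V_i(\mathbf x)=\mathbf v_{\nu,i}^\top X_\nu^{-1}\mathbf x$ on $\operatorname{cone}\nu$. There is a constant $\overline a'\ge\underline a$ such that, for all $\mathbf x\in\mathbb R^n$ and all $i,j\in\mathcal P$, $$\underline a\|\mathbf x\|\le V_i(\mathbf x)\le\overline a'\|\mathbf x\|,\qquad D^+V_i(\mathbf x,A_i\mathbf x)\le-\alpha\|\mathbf x\|,\qquad V_i(\mathbf x)\le\mu V_j(\mathbf x)\ \ (j\neq i),$$ and moreover $$D^+V_i(\mathbf x,A_i\mathbf x)\le-\frac{\alpha}{\overline a}V_i(\mathbf x).$$ Consequently, for every $\tau_a>\overline a\ln(\mu)/\alpha$ the origin is globally exponentially stable for $\dot{\mathbf x}=A_\sigma\mathbf x$ under average dwell-time $\tau_a$: there is $r>0$ such that for every $N_0>0$ there is $C>0$ such that every solution $\mathbf x$, for every switching signal $\sigma$ with average dwell-time $\tau_a$ and chatter bound $N_0$, satisfies $$\|\mathbf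 x(t)\|\le C e^{-r(t-s)}\|\mathbf x(s)\|\qquad\text{for all }0\le s\le t .$$ -/

import Mathlib

namespace FanLP

open Filter Topology MeasureTheory Set Matrix

/-- Euclidean space `ℝⁿ`; its norm is the Euclidean norm. -/
abbrev E (n : ℕ) : Type := EuclideanSpace ℝ (Fin n)

/-! ### The fan triangulation -/

/-- The maximum norm `‖x‖_∞` on `ℝⁿ`. -/
noncomputable def supNorm {n : ℕ} (x : E n) : ℝ := ‖(WithLp.ofLp x : Fin n → ℝ)‖

/-- The reflection `R^J`, which changes the sign of the coordinates in `J`. -/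
noncomputable def reflect {n : ℕ} (J : Finset (Fin n)) (x : E n) : E n :=
  WithLp.toLp 2 fun k => (if k ∈ J then (-1 : ℝ) else 1) * x k

/-- The data `(z, J, ρ)` that index the simplices of the standard triangulation. -/
structure SimplexIndex (n : ℕ) where
  z : Fin n → ℕ
  J : Finset (Fin n)
  ρ : Equiv.Perm (Fin n)

/-- The vertex `x_j = R^J (z + e_{ρ(1)} + ⋯ + e_{ρ(j)})`, `j = 0, …, n`, of the standard
triangulation.  (The indices `1, …, n` of the coordinates are `0, …, n - 1` here.) -/
noncomputable def stdVertex {n : ℕ} (ν : SimplexIndex n) (j : Fin (n + 1)) : E n :=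
  reflect ν.J (WithLp.toLp 2 (fun k => (ν.z k : ℝ)) +
    ∑ i : Fin n with i.val < j.val, EuclideanSpace.single (ν.ρ i) (1 : ℝ))

/-- The simplices of the standard triangulation that lie in the hypercube `[-K, K]ⁿ` and meet its
boundary in an `(n-1)`-simplex: the vertices `x_1, …, x_n` are on the boundary, and `x_0` is not.
(The moduli of the coordinates of `x_j` are nondecreasing in `j`, so `x_0` is the only vertex
that can be the exceptional one.) Replacing `x_0` by the origin gives the simplices of `T_K`. -/
def fanIndices (n K : ℕ) : Set (SimplexIndex n) :=
  {ν | supNorm (stdVertex ν 0) < K ∧ ∀ j : Fin n, supNorm (stdVertex ν j.succ) = K}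

/-- The map `F x = (‖x‖_∞ / ‖x‖) x`, `F 0 = 0`, which takes the hypercube surfaces
`‖x‖_∞ = r` to the spheres `‖x‖ = r`. -/
noncomputable def fanMap {n : ℕ} (x : E n) : E n := (supNorm x / ‖x‖) • x

/-- The nonzero vertices `F(x_1), …, F(x_n)` of a simplex of the fan triangulation `T_K^F`; its
remaining vertex is the origin. -/
noncomputable def vertex {n : ℕ} (ν : SimplexIndex n) (j : Fin n) : E n :=
  fanMap (stdVertex ν j.succ)

/-- The set of all vertices of simplices of `T_K^F`. -/
def vertices (n K : ℕ) : Set (E n) :=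
  {x | ∃ ν ∈ fanIndices n K, x = 0 ∨ ∃ j, x = vertex ν j}

/-- The matrix `X_ν` whose columns are the nonzero vertices of the simplex. -/
noncomputable def vertexMatrix {n : ℕ} (ν : SimplexIndex n) : Matrix (Fin n) (Fin n) ℝ :=
  Matrix.of fun k j => vertex ν j k

/-- The cone spanned by the nonzero vertices of a simplex. -/
def cone {n : ℕ} (ν : SimplexIndex n) : Set (E n) :=
  {x | ∃ c : Fin n → ℝ, (∀ j, 0 ≤ c j) ∧ x = ∑ j, c j • vertex ν j}

/-! ### The linear program -/

/-- The linear vector field `x ↦ A x`. -/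
noncomputable def linField {n : ℕ} (A : Matrix (Fin n) (Fin n) ℝ) (x : E n) : E n :=
  WithLp.toLp 2 (A *ᵥ WithLp.ofLp x)

/-- The row vector `v_{ν,i}ᵀ X_ν⁻¹` applied to `x`, where `v_{ν,i}` collects the values `w` at the
nonzero vertices of the simplex. -/
noncomputable def nodalGradient {n : ℕ} (w : E n → ℝ) (ν : SimplexIndex n) (x : E n) : ℝ :=
  (fun j => w (vertex ν j)) ⬝ᵥ ((vertexMatrix ν)⁻¹ *ᵥ WithLp.ofLp x)

/-- `(α, W)` satisfies the constraints of the linear program on `T_K^F` with constants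
`aLo`, `aHi`, `μ`; the variable `V_{x,i}` is `W i x` (only the values at vertices matter). -/
structure IsFeasible {n : ℕ} (K : ℕ) {P : Type*} (A : P → Matrix (Fin n) (Fin n) ℝ)
    (aLo aHi μ α : ℝ) (W : P → E n → ℝ) : Prop where
  zero : ∀ i, W i 0 = 0
  lower : ∀ i, ∀ x ∈ vertices n K, aLo * ‖x‖ ≤ W i x
  upper : ∀ i, ∀ x ∈ vertices n K, W i x ≤ aHi * ‖x‖
  decay : ∀ ν ∈ fanIndices n K, ∀ j i,
    nodalGradient (W i) ν (linField (A i) (vertex ν j)) ≤ -α * ‖vertex ν j‖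
  jump : ∀ i j, ∀ x ∈ vertices n K, W j x ≤ μ * W i x

/-- `V` is obtained from the vertex values `W` by linear interpolation on each simplex of `T_K^F`,
extended to the cones spanned by the simplices. -/
def IsConewiseInterpolation {n : ℕ} (K : ℕ) (W V : E n → ℝ) : Prop :=
  ∀ ν ∈ fanIndices n K, ∀ c : Fin n → ℝ, (∀ j, 0 ≤ c j) →
    V (∑ j, c j • vertex ν j) = ∑ j, c j * W (vertex ν j)

/-! ### Solutions, Dini derivatives and switched systems -/

/-- `x` is, on `[0, ∞)`, a (locally absolutely continuous) solution of `x' = f(t, x)`. -/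
def IsSolution {n : ℕ} (f : ℝ → E n → E n) (x : ℝ → E n) : Prop :=
  (∀ T, 0 ≤ T → AbsolutelyContinuousOnInterval x 0 T) ∧
    ∀ᵐ t ∂(volume.restrict (Ici (0 : ℝ))), HasDerivAt x (f t (x t)) t

/-- The upper Dini derivative at time `0` of `V` along the curve `φ`, as an extended real. -/
noncomputable def diniAlong {n : ℕ} (V : E n → ℝ) (φ : ℝ → E n) : EReal :=
  limsup (fun h : ℝ => (((V (φ h) - V (φ 0)) / h : ℝ) : EReal)) (𝓝[>] 0)

/-- `D⁺V(x, f(x)) ≤ r`: the upper Dini derivative of `V` along the solution of `x' = f(x)` that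
starts at `x` is at most `r`. -/
def DiniLE {n : ℕ} (V : E n → ℝ) (f : E n → E n) (x : E n) (r : ℝ) : Prop :=
  ∀ φ : ℝ → E n, φ 0 = x → IsSolution (fun _ => f) φ → diniAlong V φ ≤ (r : EReal)

/-- The multiple-Lyapunov-function conditions: norm-like bounds of degree `d`, decay along each
subsystem and compatibility with factor `μ`. -/
structure LyapunovConditions {n : ℕ} {P : Type*} (f : P → E n → E n) (V : P → E n → ℝ)
    (d aLo aHi α μ : ℝ) : Prop where
  d_pos : 0 < d
  aLo_pos : 0 < aLo
  aLo_le : aLo ≤ aHi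
  α_pos : 0 < α
  one_le_μ : 1 ≤ μ
  cont : ∀ i, Continuous (V i)
  lower : ∀ i x, aLo * ‖x‖ ^ d ≤ V i x
  upper : ∀ i x, V i x ≤ aHi * ‖x‖ ^ d
  decay : ∀ i x, DiniLE (V i) (f i) x (-α * ‖x‖ ^ d)
  jump : ∀ i j, j ≠ i → ∀ x, V i x ≤ μ * V j x

/-- The switching times of `σ` (its discontinuities; the set of modes is discrete). Only the
restriction of `σ` to `[0, ∞)` matters. -/
def switchTimes {P : Type*} (σ : ℝ → P) : Set ℝ :=
  {t | 0 < t ∧ ¬ ∀ᶠ s in 𝓝 t, σ s = σ t}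

/-- Switching signals: right-continuous and piecewise constant on `[0, ∞)`, with locally finitely
many switching times. -/
def IsSwitchingSignal {P : Type*} (σ : ℝ → P) : Prop :=
  (∀ t, 0 ≤ t → ∀ᶠ s in 𝓝[≥] t, σ s = σ t) ∧
    ∀ T, (switchTimes σ ∩ Iic T).Finite

/-- `N_σ(t, s) ≤ N₀ + (t - s) / τ`, where `N_σ(t, s)` is the number of switches in `(s, t)`. -/
def HasAverageDwellTime {P : Type*} (σ : ℝ → P) (τ N₀ : ℝ) : Prop :=
  ∀ s t, 0 ≤ s → s ≤ t → ((switchTimes σ ∩ Ioo s t).ncard : ℝ) ≤ N₀ + (t - s) / τ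

/-- The origin is globally exponentially stable for `x' = f_σ(x)` under average dwell-time `τ`: the
decay rate is common to all switching signals with average dwell-time `τ`, and the
overshoot constant is common to those with the same chatter bound `N₀`. -/
def IsGESUnderDwellTime {n : ℕ} {P : Type*} (f : P → E n → E n) (τ : ℝ) : Prop :=
  ∃ r : ℝ, 0 < r ∧ ∀ N₀ : ℝ, 0 < N₀ → ∃ C : ℝ, 0 < C ∧
    ∀ σ : ℝ → P, IsSwitchingSignal σ → HasAverageDwellTime σ τ N₀ →
      ∀ x : ℝ → E n, IsSolution (fun t => f (σ t)) x →
        ∀ s t, 0 ≤ s → s ≤ t → ‖x t‖ ≤ C * Real.exp (-r * (t - s)) * ‖x s‖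

end FanLP

/-!
The vertices `F(x_j)` are positive multiples of the lattice points `x_j` of the standard triangulation,
so the cones are those over the simplices into which that triangulation divides the surface of the
cube `[-K, K]ⁿ`. In such a simplex, with `D = ∑ d_j`, the coordinate `ρ(m)` of `∑ d_j x_j` is, up to
a fixed sign, `z_{ρ(m)} D + ∑_{j ≥ m} d_j` (`sum_stdVertex_apply`). This triangular system gives linear independence
(`linearIndependent_vertex`), and solving it by rounding and sorting shows that the cones cover the
space (`exists_mem_cone`).

The interpolation is well defined, although cones overlap in common faces, because its value at `x`
can be written without reference to a simplex. For `x ≠ 0` let `u = x / D` with `D = ‖x‖_∞ / K`. If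
`x` lies in the cone over the simplex with vertices `x_1, …, x_n`, then for `φ ∈ (0, 1]` the lattice point `sign(x_k) (⌈|u_k| + φ⌉ - 1)` is the vertex `x_j` precisely for `φ` in an interval of length
`d_j / D`. Hence `∑ d_j U(x_j) = D ∫₀¹ U(…) dφ` (`latticeInterp_sum_stdVertex`). In particular no
analysis of how two simplices intersect is needed.

On each of the finitely many closed cones the interpolation is a linear form, which gives continuity
and transfers the constraints of the linear program from the vertices to all points. For the Dini
derivative, points near `x` lie in cones that contain `x`, so difference quotients at `x` are values
of finitely many linear forms at difference quotients of the solution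
(`IsConewiseInterpolation.eventually_slope_lt`).

A solution is absolutely continuous and, between switches, right differentiable everywhere
(`hasDerivWithinAt_Ici_of_ae_hasDerivAt`). Grönwall's inequality then gives exponential decay of `V_i`
with rate `α / aHi` on each interval without switches, a switch costs at most a factor `μ`, and
counting switches yields the stability (`isGESUnderDwellTime_of_decay`).
-/

namespace FanLP

open Filter Topology MeasureTheory Set Matrix

/-! ### The simplices of the fan triangulation -/

/-- The `k`-th diagonal entry of the reflection `R^J` of a simplex index. -/
noncomputable def refSign {n : ℕ} (ν : SimplexIndex n) (k : Fin n) : ℝ := if k ∈ ν.J then -1 else 1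

lemma refSign_mul_self {n : ℕ} (ν : SimplexIndex n) (k : Fin n) :
    refSign ν k * refSign ν k = 1 := by
  unfold refSign; split_ifs <;> norm_num

lemma abs_refSign {n : ℕ} (ν : SimplexIndex n) (k : Fin n) : |refSign ν k| = 1 := by
  unfold refSign; split_ifs <;> norm_num

/-- The coordinate `ρ(m)` is raised by one exactly from the vertex `x_{m+1}` on, in zero-based
numbering of `m`. -/
lemma stdVertex_apply {n : ℕ} (ν : SimplexIndex n) (j : Fin (n + 1)) (k : Fin n) :
    stdVertex ν j k =
      refSign ν k * (ν.z k + if (ν.ρ.symm k).val < j.val then 1 else 0) := by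
  simp only [stdVertex, reflect, refSign, PiLp.add_apply, WithLp.ofLp_sum, Finset.sum_apply,
    PiLp.single_apply]
  congr 2
  rw [Finset.sum_filter, Finset.sum_eq_single (ν.ρ.symm k)]
  · simp
  · intro b _ hb
    rw [if_neg fun h : k = ν.ρ b => hb (by rw [h, Equiv.symm_apply_apply]), ite_self]
  · simp

lemma abs_stdVertex_apply {n : ℕ} (ν : SimplexIndex n) (j : Fin (n + 1)) (k : Fin n) :
    |stdVertex ν j k| = ν.z k + if (ν.ρ.symm k).val < j.val then 1 else 0 := by
  rw [stdVertex_apply, abs_mul, abs_refSign, one_mul, abs_of_nonneg]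
  positivity

lemma supNorm_eq_iff {n : ℕ} {x : E n} {r : ℝ} (hr : 0 < r) :
    supNorm x = r ↔ (∀ k, |x k| ≤ r) ∧ ∃ k, |x k| = r := by
  unfold supNorm
  constructor
  · rintro rfl
    refine ⟨fun k => norm_le_pi_norm (WithLp.ofLp x) k, ?_⟩
    by_contra! h
    have := (pi_norm_lt_iff hr).2 fun k =>
      lt_of_le_of_ne (norm_le_pi_norm (WithLp.ofLp x) k) (h k)
    exact lt_irrefl _ this
  · rintro ⟨h, k, hk⟩
    exact le_antisymm ((pi_norm_le_iff_of_nonneg hr.le).2 h)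
      (hk ▸ norm_le_pi_norm (WithLp.ofLp x) k)

/-- The boundary condition on a simplex concerns `z` and `ρ(1)` only: up to
reflection, the cube `z + [0, 1]ⁿ` lies in `[0, K]ⁿ`, and the first step leads to the face
`{x_{ρ(1)} = K}`. -/
lemma mem_fanIndices_iff {n K : ℕ} (hK : 0 < K) (ν : SimplexIndex n) :
    ν ∈ fanIndices n K ↔
      (∀ k, ν.z k < K) ∧ ∀ k, (ν.ρ.symm k).val = 0 → ν.z k + 1 = K := by
  have hK' : (0 : ℝ) < K := by exact_mod_cast hK
  have h0 : supNorm (stdVertex ν 0) < K ↔ ∀ k, ν.z k < K := by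
    rw [supNorm, pi_norm_lt_iff hK']
    refine forall_congr' fun k => ?_
    rw [Real.norm_eq_abs, abs_stdVertex_apply]
    simp
  simp only [fanIndices, mem_ofPred_eq, h0]
  refine and_congr_right fun hz => ⟨fun h k hk => ?_, fun h j => ?_⟩
  · obtain ⟨-, l, hl⟩ := (supNorm_eq_iff hK').1 (h (ν.ρ.symm k))
    rw [abs_stdVertex_apply] at hl
    have hlt := hz l
    split_ifs at hl with h1
    · have h2 : ν.ρ.symm l = ν.ρ.symm k := by
        apply Fin.ext
        simp only [Fin.val_succ] at h1
        omega
      rw [← ν.ρ.symm.injective h2]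
      exact Nat.cast_injective (R := ℝ) (by push_cast; exact hl)
    · have : ν.z l = K := by exact_mod_cast (by simpa using hl)
      omega
  · rw [supNorm_eq_iff hK']
    refine ⟨fun k => ?_, ν.ρ ⟨0, j.pos⟩, ?_⟩
    · rw [abs_stdVertex_apply]
      have : ν.z k + 1 ≤ K := hz k
      have : (ν.z k : ℝ) + 1 ≤ K := by exact_mod_cast this
      split_ifs <;> linarith
    · rw [abs_stdVertex_apply, Equiv.symm_apply_apply]
      simp only [Fin.val_succ, Nat.succ_pos, if_true]
      exact_mod_cast h _ (by simp)

/-- The sum of the first `m` entries of `d`. -/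
noncomputable def partialSum {n : ℕ} (d : Fin n → ℝ) (m : ℕ) : ℝ :=
  ∑ j : Fin n with j.val < m, d j

lemma partialSum_zero {n : ℕ} (d : Fin n → ℝ) : partialSum d 0 = 0 := by
  simp [partialSum]

lemma partialSum_self {n : ℕ} (d : Fin n → ℝ) : partialSum d n = ∑ j, d j := by
  simp [partialSum]

lemma partialSum_succ {n : ℕ} (d : Fin n → ℝ) (j : Fin n) :
    partialSum d (j + 1) = partialSum d j + d j := by
  have : (Finset.univ.filter fun i : Fin n => i.val < j.val + 1) =
      insert j (Finset.univ.filter fun i : Fin n => i.val < j.val) := by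
    ext i
    simp only [Finset.mem_filter, Finset.mem_univ, true_and, Finset.mem_insert, Fin.ext_iff]
    omega
  rw [partialSum, this, Finset.sum_insert (by simp), add_comm]
  rfl

lemma partialSum_mono {n : ℕ} {d : Fin n → ℝ} (hd : ∀ j, 0 ≤ d j) : Monotone (partialSum d) := by
  intro a b hab
  refine Finset.sum_le_sum_of_subset_of_nonneg ?_ fun j _ _ => hd j
  intro i
  simp only [Finset.mem_filter, Finset.mem_univ, true_and]
  omega

/-- With `D = ∑ d_j`, the coordinate `k` is `± (z_k D + ∑_{j ≥ m} d_j)`, where `k = ρ(m)`; the tail is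
written as `D` minus a partial sum. -/
lemma sum_stdVertex_apply {n : ℕ} (ν : SimplexIndex n) (d : Fin n → ℝ) (k : Fin n) :
    (∑ j, d j • stdVertex ν j.succ) k =
      refSign ν k * ((ν.z k + 1) * (∑ j, d j) - partialSum d (ν.ρ.symm k)) := by
  simp only [WithLp.ofLp_sum, Finset.sum_apply, PiLp.smul_apply, stdVertex_apply, smul_eq_mul,
    partialSum]
  have : ∀ j : Fin n, d j * (refSign ν k * (ν.z k + if (ν.ρ.symm k).val < j.succ.val then 1 else 0))
      = refSign ν k * ((ν.z k + 1) * d j - if j.val < (ν.ρ.symm k).val then d j else 0) := by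
    intro j
    simp only [Fin.val_succ]
    by_cases h : j.val < (ν.ρ.symm k).val
    · rw [if_pos h, if_neg (by omega)]; ring
    · rw [if_neg h, if_pos (by omega)]; ring
  simp only [this]
  rw [← Finset.mul_sum, Finset.sum_sub_distrib, ← Finset.mul_sum, Finset.sum_filter]

/-- The first coordinate in the order `ρ` forces `∑ d_j = 0`; the others then make all partial sums
of `d` vanish. -/
lemma linearIndependent_stdVertex {n : ℕ} (ν : SimplexIndex n) :
    LinearIndependent ℝ fun j : Fin n => stdVertex ν j.succ := by
  rw [Fintype.linearIndependent_iff]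
  intro d hd
  have h1 : ∀ m : Fin n, (ν.z (ν.ρ m) + 1) * (∑ j, d j) = partialSum d m := by
    intro m
    have := sum_stdVertex_apply ν d (ν.ρ m)
    rw [hd, Equiv.symm_apply_apply] at this
    have h2 : refSign ν (ν.ρ m) ≠ 0 := fun h => by simpa [h] using refSign_mul_self ν (ν.ρ m)
    have h3 := (mul_eq_zero.1 this.symm).resolve_left h2
    linarith
  intro i
  have hD : ∑ j, d j = 0 := by
    have := h1 ⟨0, i.pos⟩
    simp only [partialSum_zero] at this
    refine (mul_eq_zero.1 this).resolve_left ?_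
    positivity
  have h2 : ∀ m : ℕ, m ≤ n → partialSum d m = 0 := by
    intro m hm
    rcases hm.lt_or_eq with h | rfl
    · simpa [hD] using (h1 ⟨m, h⟩).symm
    · rw [partialSum_self, hD]
  have := partialSum_succ d i
  rw [h2 _ i.isLt, h2 _ i.isLt.le] at this
  linarith

/-- The maximum norm is linear on the cone over a boundary simplex: the coordinate `ρ(1)` has
the maximal modulus at all of its vertices. -/
lemma supNorm_sum_stdVertex {n K : ℕ} (hK : 0 < K) {ν : SimplexIndex n} (hν : ν ∈ fanIndices n K)
    {d : Fin n → ℝ} (hd : ∀ j, 0 ≤ d j) :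
    supNorm (∑ j, d j • stdVertex ν j.succ) = K * ∑ j, d j := by
  have hK' : (0 : ℝ) < K := by exact_mod_cast hK
  rcases (Finset.sum_nonneg fun j _ => hd j : 0 ≤ ∑ j, d j).eq_or_lt with h | h
  · have h0 : ∀ j, d j = 0 := fun j =>
      (Finset.sum_eq_zero_iff_of_nonneg fun j _ => hd j).1 h.symm j (Finset.mem_univ j)
    simp [h0, supNorm]
  · obtain ⟨hz, hz0⟩ := (mem_fanIndices_iff hK ν).1 hν
    rw [supNorm_eq_iff (by positivity)]
    have hS0 : ∀ m, 0 ≤ partialSum d m := fun m => Finset.sum_nonneg fun j _ => hd j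
    have hS1 : ∀ k : Fin n, partialSum d k ≤ ∑ j, d j := fun k =>
      partialSum_self d ▸ partialSum_mono hd k.isLt.le
    refine ⟨fun k => ?_, ?_⟩
    · rw [sum_stdVertex_apply, abs_mul, abs_refSign, one_mul]
      have : (ν.z k : ℝ) + 1 ≤ K := by exact_mod_cast hz k
      have h3 := mul_le_mul_of_nonneg_right this h.le
      have h4 : 0 ≤ (ν.z k : ℝ) * ∑ j, d j := by positivity
      have := hS0 (ν.ρ.symm k)
      have := hS1 (ν.ρ.symm k)
      rw [abs_of_nonneg] <;> linarith
    · have hn : 0 < n := by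
        rcases Nat.eq_zero_or_pos n with rfl | hn
        · simp at h
        · exact hn
      refine ⟨ν.ρ ⟨0, hn⟩, ?_⟩
      have : (ν.z (ν.ρ ⟨0, hn⟩) : ℝ) + 1 = K := by exact_mod_cast hz0 _ (by simp)
      rw [sum_stdVertex_apply, abs_mul, abs_refSign, one_mul, this, Equiv.symm_apply_apply,
        partialSum_zero, sub_zero, abs_of_nonneg (by positivity)]

/-! ### A formula for the interpolation that does not refer to simplices -/

/-- The lattice point `k ↦ sign(x_k) (⌈|u_k| + φ⌉ - 1)` with `u = (K / ‖x‖_∞) x`. As `φ` runs through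
`(0, 1]`, it visits the vertices `x_1, …, x_n` of any boundary simplex whose cone contains `x ≠ 0`, in
this order, and stays at `x_j` for a time equal to the barycentric coordinate of `u` there. -/
noncomputable def latticeStep {n : ℕ} (K : ℕ) (x : E n) (φ : ℝ) : E n :=
  WithLp.toLp 2 fun k => (SignType.sign (x k) : ℝ) * (⌈|x k| / (supNorm x / K) + φ⌉ - 1)

/-- The conewise linear interpolation of the values `U` at the lattice points on the surface of the
cube, with the barycentric sum expressed as an integral over the times spent by `latticeStep`. -/
noncomputable def latticeInterp {n : ℕ} (K : ℕ) (U : E n → ℝ) (x : E n) : ℝ :=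
  supNorm x / K * ∫ φ in (0 : ℝ)..1, U (latticeStep K x φ)

lemma latticeStep_sum_stdVertex {n K : ℕ} (hK : 0 < K) {ν : SimplexIndex n}
    (hν : ν ∈ fanIndices n K) {d : Fin n → ℝ} (hd : ∀ j, 0 ≤ d j) (hD : 0 < ∑ j, d j)
    (j : Fin n) {φ : ℝ}
    (hφ : φ ∈ Ioc (partialSum d j / ∑ j, d j) (partialSum d (j + 1) / ∑ j, d j)) :
    latticeStep K (∑ j, d j • stdVertex ν j.succ) φ = stdVertex ν j.succ := by
  have hK' : (0 : ℝ) < K := by exact_mod_cast hK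
  set D := ∑ j, d j with hDdef
  ext k
  have hS0 : ∀ m, 0 ≤ partialSum d m := fun m => Finset.sum_nonneg fun j _ => hd j
  have hS1 : ∀ k : Fin n, partialSum d k ≤ D := fun k => by
    rw [hDdef, ← partialSum_self d]
    exact partialSum_mono hd k.isLt.le
  set s := partialSum d (ν.ρ.symm k) / D with hs
  have hs0 : 0 ≤ s := div_nonneg (hS0 _) hD.le
  have hs1 : s ≤ 1 := (div_le_one hD).2 (hS1 _)
  have hx : (∑ j, d j • stdVertex ν j.succ) k = refSign ν k * (D * (ν.z k + 1 - s)) := by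
    rw [sum_stdVertex_apply, hs]
    congr 1
    rw [mul_sub, mul_div_cancel₀ _ hD.ne']
    ring
  have hu : 0 ≤ (ν.z k : ℝ) + 1 - s := by
    have : (0 : ℝ) ≤ ν.z k := by positivity
    linarith
  have habs : |(∑ j, d j • stdVertex ν j.succ) k| / (supNorm (∑ j, d j • stdVertex ν j.succ) / K)
      = ν.z k + 1 - s := by
    rw [supNorm_sum_stdVertex hK hν hd, hx, abs_mul, abs_refSign, one_mul,
      abs_of_nonneg (by positivity), ← hDdef]
    field_simp
  have hφ0 : 0 < φ := lt_of_le_of_lt (div_nonneg (hS0 _) hD.le) hφ.1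
  have hφ1 : φ ≤ 1 := hφ.2.trans <| (div_le_one hD).2 <| by
    rw [hDdef, ← partialSum_self d]
    exact partialSum_mono hd j.isLt
  have hceil : (⌈(ν.z k : ℝ) + 1 - s + φ⌉ : ℝ) - 1 =
      ν.z k + if (ν.ρ.symm k).val < j.succ.val then 1 else 0 := by
    simp only [Fin.val_succ]
    by_cases h : (ν.ρ.symm k).val < j.val + 1
    · rw [if_pos h]
      have h1 : s ≤ partialSum d j / D := by
        rw [hs]; gcongr; exact partialSum_mono hd (by omega)
      have : ⌈(ν.z k : ℝ) + 1 - s + φ⌉ = (ν.z k : ℤ) + 2 := by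
        rw [Int.ceil_eq_iff]
        push_cast
        constructor <;> linarith [hφ.1]
      rw [this]; push_cast; ring
    · rw [if_neg h]
      have h1 : partialSum d (j + 1) / D ≤ s := by
        rw [hs]; gcongr; exact partialSum_mono hd (by omega)
      have : ⌈(ν.z k : ℝ) + 1 - s + φ⌉ = (ν.z k : ℤ) + 1 := by
        rw [Int.ceil_eq_iff]
        push_cast
        constructor <;> linarith [hφ.2]
      rw [this]; push_cast; ring
  rw [stdVertex_apply]
  simp only [latticeStep, habs, hceil]
  rcases hu.eq_or_lt with h0 | h0
  · -- a vanishing coordinate: `z k = 0` and the coordinate of the vertex vanishes, too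
    have hz0 : (ν.z k : ℝ) = 0 := by
      have : (0 : ℝ) ≤ ν.z k := by positivity
      linarith
    have hnot : ¬ (ν.ρ.symm k).val < j.succ.val := by
      simp only [Fin.val_succ]
      intro h
      have h1 : s ≤ partialSum d j / D := by
        rw [hs]; gcongr; exact partialSum_mono hd (by omega)
      linarith [hφ.1]
    rw [hz0, if_neg hnot, add_zero, mul_zero, mul_zero]
  · congr 1
    rw [hx]
    have h1 : 0 < D * (ν.z k + 1 - s) := by positivity
    unfold refSign
    split_ifs
    · rw [sign_neg (by linarith)]; simp
    · rw [sign_pos (by linarith)]; simp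

lemma latticeInterp_sum_stdVertex {n K : ℕ} (hK : 0 < K) (U : E n → ℝ) {ν : SimplexIndex n}
    (hν : ν ∈ fanIndices n K) {d : Fin n → ℝ} (hd : ∀ j, 0 ≤ d j) :
    latticeInterp K U (∑ j, d j • stdVertex ν j.succ) = ∑ j, d j * U (stdVertex ν j.succ) := by
  have hK' : (0 : ℝ) < K := by exact_mod_cast hK
  rcases (Finset.sum_nonneg fun j _ => hd j : 0 ≤ ∑ j, d j).eq_or_lt with h | h
  · have h0 : ∀ j, d j = 0 := fun j =>
      (Finset.sum_eq_zero_iff_of_nonneg fun j _ => hd j).1 h.symm j (Finset.mem_univ j)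
    simp [h0, supNorm, latticeInterp]
  · set x := ∑ j, d j • stdVertex ν j.succ with hx
    set D := ∑ j, d j with hD
    set s : ℕ → ℝ := fun m => partialSum d m / D with hs
    have hmono : Monotone s := fun a b hab => by
      simp only [hs]; gcongr; exact partialSum_mono hd hab
    have hcongr : ∀ j : Fin n, ∀ φ ∈ uIoc (s j) (s (j + 1)),
        U (stdVertex ν j.succ) = U (latticeStep K x φ) := by
      intro j φ hφ
      rw [uIoc_of_le (hmono (Nat.le_succ _))] at hφ
      rw [hx, latticeStep_sum_stdVertex hK hν hd h j hφ]
    have hint : ∀ j < n, IntervalIntegrable (fun φ => U (latticeStep K x φ)) volume (s j)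
        (s (j + 1)) := by
      intro j hj
      exact (intervalIntegrable_const (c := U (stdVertex ν (Fin.succ ⟨j, hj⟩)))).congr
        (hcongr ⟨j, hj⟩)
    have hsum := intervalIntegral.sum_integral_adjacent_intervals hint
    have hs0 : s 0 = 0 := by simp [hs, partialSum_zero]
    have hsn : s n = 1 := by simp [hs, partialSum_self, ← hD, h.ne']
    rw [hs0, hsn] at hsum
    rw [latticeInterp, ← hsum, Finset.sum_range, hx, supNorm_sum_stdVertex hK hν hd, ← hx,
      Finset.mul_sum]
    refine Finset.sum_congr rfl fun j _ => ?_
    rw [← intervalIntegral.integral_congr_ae (Eventually.of_forall (hcongr j)),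
      intervalIntegral.integral_const, smul_eq_mul]
    simp only [hs, partialSum_succ, ← hD]
    field_simp
    ring

lemma stdVertex_succ_ne_zero {n K : ℕ} (hK : 0 < K) {ν : SimplexIndex n}
    (hν : ν ∈ fanIndices n K) (j : Fin n) : stdVertex ν j.succ ≠ 0 := by
  intro h
  have := hν.2 j
  rw [h] at this
  simp only [supNorm, WithLp.ofLp_zero, norm_zero] at this
  exact hK.ne (by exact_mod_cast this)

lemma vertex_eq {n K : ℕ} {ν : SimplexIndex n} (hν : ν ∈ fanIndices n K) (j : Fin n) :
    vertex ν j = (K / ‖stdVertex ν j.succ‖) • stdVertex ν j.succ := by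
  rw [vertex, fanMap, hν.2 j]

theorem linearIndependent_vertex {n K : ℕ} (hK : 0 < K) {ν : SimplexIndex n}
    (hν : ν ∈ fanIndices n K) : LinearIndependent ℝ (vertex ν) := by
  have hK' : (K : ℝ) ≠ 0 := by exact_mod_cast hK.ne'
  have := (linearIndependent_stdVertex ν).units_smul fun j =>
    Units.mk0 (K / ‖stdVertex ν j.succ‖)
      (div_ne_zero hK' (norm_ne_zero_iff.2 (stdVertex_succ_ne_zero hK hν j)))
  convert this using 1
  ext1 j
  rw [vertex_eq hν]
  rfl

/-- The conewise linear interpolation of the values `w` at the vertices of the fan triangulation. The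
vertex `F(p)` is the multiple of `p` of Euclidean norm `K`, and degree-one homogeneity turns the value
`w (F p)` at `F(p)` into the value `w (F p) ‖p‖ / K` at `p`. -/
noncomputable def fanInterp {n : ℕ} (K : ℕ) (w : E n → ℝ) : E n → ℝ :=
  latticeInterp K fun p => w (fanMap p) * ‖p‖ / K

theorem isConewiseInterpolation_fanInterp {n K : ℕ} (hK : 0 < K) (w : E n → ℝ) :
    IsConewiseInterpolation K w (fanInterp K w) := by
  intro ν hν c hc
  have hK' : (0 : ℝ) < K := by exact_mod_cast hK
  have h1 : ∑ j, c j • vertex ν j =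
      ∑ j, (c j * (K / ‖stdVertex ν j.succ‖)) • stdVertex ν j.succ :=
    Finset.sum_congr rfl fun j _ => by rw [vertex_eq hν, smul_smul]
  rw [h1, fanInterp, latticeInterp_sum_stdVertex hK _ hν fun j => by have := hc j; positivity]
  refine Finset.sum_congr rfl fun j _ => ?_
  have := norm_pos_iff.2 (stdVertex_succ_ne_zero hK hν j)
  simp only [vertex]
  field_simp

/-! ### The cones cover the space -/

/-- Rescale `x` to the surface of the cube, take for `z` the integral parts of the moduli of the
coordinates, but at most `K - 1`, and let `ρ` order the coordinates by decreasing remainder. -/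
lemma exists_sum_stdVertex_eq {n K : ℕ} (hK : 0 < K) (x : E n) :
    ∃ ν ∈ fanIndices n K, ∃ d : Fin n → ℝ, (∀ j, 0 ≤ d j) ∧
      x = ∑ j, d j • stdVertex ν j.succ := by
  have hK' : (0 : ℝ) < K := by exact_mod_cast hK
  rcases (norm_nonneg (WithLp.ofLp x) : 0 ≤ supNorm x).eq_or_lt with h | (h : 0 < supNorm x)
  · have hx : x = 0 := by
      have := norm_eq_zero.1 h.symm
      ext k
      simp [this]
    refine ⟨⟨fun _ => K - 1, ∅, 1⟩, ?_, 0, fun _ => le_rfl, by simp [hx]⟩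
    rw [mem_fanIndices_iff hK]
    exact ⟨fun _ => by simp; omega, fun _ _ => by simp; omega⟩
  set D := supNorm x / K with hD
  have hD0 : 0 < D := by positivity
  obtain ⟨hle, k₀, hk₀⟩ := (supNorm_eq_iff h).1 rfl
  set u : Fin n → ℝ := fun k => |x k| / D with hu
  have hu0 : ∀ k, 0 ≤ u k := fun k => by positivity
  have hxD : ∀ k, D * u k = |x k| := fun k => by simp only [hu]; field_simp
  have huK : ∀ k, u k ≤ K := fun k => by
    simp only [hu]
    rw [div_le_iff₀ hD0, hD, mul_div_cancel₀ _ hK'.ne']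
    exact hle k
  have huk₀ : u k₀ = K := by
    simp only [hu, hk₀, hD]
    rw [div_div_cancel₀ h.ne']
  -- with this choice `u k - z k = 1` only if `u k = K`, so that sorting puts such a `k` first
  set z : Fin n → ℕ := fun k => min ⌊u k⌋₊ (K - 1) with hz
  set t : Fin n → ℝ := fun k => u k - z k with ht
  have hzlt : ∀ k, z k < K := fun k => lt_of_le_of_lt (min_le_right _ _) (by omega)
  have hzu : ∀ k, (z k : ℝ) ≤ u k := fun k =>
    le_trans (by exact_mod_cast min_le_left _ _) (Nat.floor_le (hu0 k))
  have hcase : ∀ k, t k < 1 ∨ z k + 1 = K := fun k => by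
    rcases le_total ⌊u k⌋₊ (K - 1) with h1 | h1
    · left
      have h2 : z k = ⌊u k⌋₊ := min_eq_left h1
      have := Nat.lt_floor_add_one (u k)
      simp only [ht, h2]
      linarith
    · right
      have h2 : z k = K - 1 := min_eq_right h1
      omega
  have ht1 : ∀ k, t k ≤ 1 := fun k => by
    rcases hcase k with h1 | h1
    · exact h1.le
    · have : (z k : ℝ) + 1 = K := by exact_mod_cast h1
      have := huK k
      simp only [ht]
      linarith
  have htk₀ : 1 ≤ t k₀ := by
    have : (z k₀ : ℝ) + 1 ≤ K := by exact_mod_cast hzlt k₀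
    simp only [ht, huk₀]
    linarith
  set ρ := Tuple.sort fun k => -t k with hρ
  have hsort : Monotone fun m => -t (ρ m) := Tuple.monotone_sort fun k => -t k
  have hρ0 : ∀ k, (ρ.symm k).val = 0 → t k = 1 := fun k hk => by
    have h1 : ρ.symm k ≤ ρ.symm k₀ := Fin.le_def.2 (by omega)
    have h2 := hsort h1
    simp only [Equiv.apply_symm_apply] at h2
    exact le_antisymm (ht1 k) (by linarith)
  set s : ℕ → ℝ := fun m => if h : m < n then 1 - t (ρ ⟨m, h⟩) else 1 with hs
  have hs0 : s 0 = 0 := by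
    have hn : 0 < n := k₀.pos
    simp only [hs, hn, dif_pos]
    rw [hρ0 _ (by simp)]
    ring
  have ht0 : ∀ k, 0 ≤ t k := fun k => sub_nonneg.2 (hzu k)
  have hsmono : ∀ m, s m ≤ s (m + 1) := fun m => by
    simp only [hs]
    split_ifs with h1 h2 h2
    · have := hsort (show (⟨m, h1⟩ : Fin n) ≤ ⟨m + 1, h2⟩ from Fin.le_def.2 (by simp))
      simp only at this
      linarith
    · linarith [ht0 (ρ ⟨m, h1⟩)]
    · omega
    · exact le_rfl
  set ν : SimplexIndex n := ⟨z, Finset.univ.filter fun k => x k < 0, ρ⟩ with hν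
  set d : Fin n → ℝ := fun j => D * (s (j + 1) - s j) with hd
  have hpart : ∀ m ≤ n, partialSum d m = D * s m := by
    intro m
    induction m with
    | zero => intro _; rw [partialSum_zero, hs0, mul_zero]
    | succ m ih =>
      intro hm
      rw [partialSum_succ d ⟨m, hm⟩, ih (by omega)]
      simp only [hd]
      ring
  refine ⟨ν, ?_, d, fun j => mul_nonneg hD0.le (sub_nonneg.2 (hsmono j)), ?_⟩
  · rw [mem_fanIndices_iff hK]
    refine ⟨hzlt, fun k hk => (hcase k).resolve_left ?_⟩
    rw [hρ0 k hk]
    exact lt_irrefl _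
  · have hsn : s n = 1 := by simp [hs]
    ext k
    rw [sum_stdVertex_apply, hpart _ (ν.ρ.symm k).isLt.le, ← partialSum_self d, hpart n le_rfl, hsn]
    have h1 : s (ν.ρ.symm k) = 1 - t k := by simp [hs, hν]
    have h2 : ((z k : ℝ) + 1) * (D * 1) - D * (1 - t k) = |x k| := by
      rw [← hxD]; simp only [ht]; ring
    rw [h1, h2]
    simp only [refSign, hν, Finset.mem_filter, Finset.mem_univ, true_and]
    split_ifs with h3
    · rw [abs_of_neg h3]; ring
    · rw [abs_of_nonneg (not_lt.1 h3)]; ring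

theorem exists_mem_cone {n K : ℕ} (hK : 0 < K) (x : E n) : ∃ ν ∈ fanIndices n K, x ∈ cone ν := by
  have hK' : (0 : ℝ) < K := by exact_mod_cast hK
  obtain ⟨ν, hν, d, hd, rfl⟩ := exists_sum_stdVertex_eq hK x
  refine ⟨ν, hν, fun j => d j * (‖stdVertex ν j.succ‖ / K),
    fun j => by have := hd j; positivity, Finset.sum_congr rfl fun j _ => ?_⟩
  have := norm_pos_iff.2 (stdVertex_succ_ne_zero hK hν j)
  rw [vertex_eq hν, smul_smul]
  congr 1
  field_simp

theorem finite_fanIndices {n K : ℕ} (hK : 0 < K) : (fanIndices n K).Finite := by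
  have : Set.InjOn (fun ν : SimplexIndex n => (ν.z, ν.J, ν.ρ)) (fanIndices n K) := by
    rintro ⟨z, J, ρ⟩ - ⟨z', J', ρ'⟩ - h
    simp_all
  refine Set.Finite.of_finite_image (Set.Finite.subset
    ((Set.finite_Iic (fun _ : Fin n => K)).prod (Set.finite_univ (α := Finset (Fin n) × _))) ?_)
    this
  rintro _ ⟨ν, hν, rfl⟩
  exact ⟨fun k => (((mem_fanIndices_iff hK ν).1 hν).1 k).le, mem_univ _⟩

/-! ### Conewise linear functions -/

/-- The linear form `x ↦ v_νᵀ X_ν⁻¹ x` as a continuous linear map. -/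
noncomputable def nodalGradientCLM {n : ℕ} (w : E n → ℝ) (ν : SimplexIndex n) : E n →L[ℝ] ℝ :=
  LinearMap.toContinuousLinearMap
    { toFun := nodalGradient w ν
      map_add' := fun x y => by simp [nodalGradient, Matrix.mulVec_add, dotProduct_add]
      map_smul' := fun c x => by simp [nodalGradient, Matrix.mulVec_smul, dotProduct_smul] }

lemma nodalGradientCLM_apply {n : ℕ} (w : E n → ℝ) (ν : SimplexIndex n) (x : E n) :
    nodalGradientCLM w ν x = nodalGradient w ν x := rfl

lemma isUnit_vertexMatrix {n K : ℕ} (hK : 0 < K) {ν : SimplexIndex n}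
    (hν : ν ∈ fanIndices n K) : IsUnit (vertexMatrix ν) := by
  rw [← Matrix.linearIndependent_cols_iff_isUnit]
  exact (linearIndependent_vertex hK hν).map' (WithLp.linearEquiv 2 ℝ (Fin n → ℝ)).toLinearMap
    (LinearEquiv.ker _)

lemma ofLp_sum_smul_vertex {n : ℕ} (ν : SimplexIndex n) (c : Fin n → ℝ) :
    WithLp.ofLp (∑ j, c j • vertex ν j) = vertexMatrix ν *ᵥ c := by
  ext k
  simp [vertexMatrix, Matrix.mulVec, dotProduct, mul_comm]

lemma inv_vertexMatrix_mulVec_sum {n K : ℕ} (hK : 0 < K) {ν : SimplexIndex n}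
    (hν : ν ∈ fanIndices n K) (c : Fin n → ℝ) :
    (vertexMatrix ν)⁻¹ *ᵥ WithLp.ofLp (∑ j, c j • vertex ν j) = c := by
  rw [ofLp_sum_smul_vertex, Matrix.mulVec_mulVec, Matrix.nonsing_inv_mul _
    ((Matrix.isUnit_iff_isUnit_det _).1 (isUnit_vertexMatrix hK hν)), Matrix.one_mulVec]

lemma nodalGradient_sum {n K : ℕ} (hK : 0 < K) (w : E n → ℝ) {ν : SimplexIndex n}
    (hν : ν ∈ fanIndices n K) (c : Fin n → ℝ) :
    nodalGradient w ν (∑ j, c j • vertex ν j) = ∑ j, c j * w (vertex ν j) := by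
  rw [nodalGradient, inv_vertexMatrix_mulVec_sum hK hν, dotProduct]
  exact Finset.sum_congr rfl fun j _ => mul_comm _ _

lemma isClosed_cone {n K : ℕ} (hK : 0 < K) {ν : SimplexIndex n} (hν : ν ∈ fanIndices n K) :
    IsClosed (cone ν) := by
  have h : cone ν = {x | ∀ j, 0 ≤ ((vertexMatrix ν)⁻¹ *ᵥ WithLp.ofLp x) j} := by
    ext x
    constructor
    · rintro ⟨c, hc, rfl⟩
      rw [mem_ofPred_eq, inv_vertexMatrix_mulVec_sum hK hν]
      exact hc
    · intro hx
      refine ⟨_, hx, ?_⟩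
      apply WithLp.ofLp_injective 2
      rw [ofLp_sum_smul_vertex, Matrix.mulVec_mulVec, Matrix.mul_nonsing_inv _
        ((Matrix.isUnit_iff_isUnit_det _).1 (isUnit_vertexMatrix hK hν)), Matrix.one_mulVec]
  rw [h, ofPred_forall]
  refine isClosed_iInter fun j => isClosed_le continuous_const ?_
  have : Continuous fun x : E n => (vertexMatrix ν)⁻¹ *ᵥ WithLp.ofLp x :=
    Continuous.matrix_mulVec continuous_const (PiLp.continuous_ofLp 2 _)
  exact (continuous_apply j).comp this

theorem IsConewiseInterpolation.eq_nodalGradient {n K : ℕ} (hK : 0 < K) {W V : E n → ℝ}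
    (h : IsConewiseInterpolation K W V) {ν : SimplexIndex n} (hν : ν ∈ fanIndices n K)
    {x : E n} (hx : x ∈ cone ν) : V x = nodalGradient W ν x := by
  obtain ⟨c, hc, rfl⟩ := hx
  rw [h ν hν c hc, nodalGradient_sum hK W hν]

theorem IsConewiseInterpolation.unique {n K : ℕ} (hK : 0 < K) {W V V' : E n → ℝ}
    (h : IsConewiseInterpolation K W V) (h' : IsConewiseInterpolation K W V') : V' = V := by
  ext x
  obtain ⟨ν, hν, hx⟩ := exists_mem_cone hK x
  rw [h.eq_nodalGradient hK hν hx, h'.eq_nodalGradient hK hν hx]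

/-- Linear on each member of a finite closed cover. -/
theorem IsConewiseInterpolation.continuous {n K : ℕ} (hK : 0 < K) {W V : E n → ℝ}
    (h : IsConewiseInterpolation K W V) : Continuous V := by
  have : Finite (fanIndices n K) := (finite_fanIndices hK).to_subtype
  refine (locallyFinite_of_finite fun ν : fanIndices n K => cone ν.1).continuous ?_
    (fun ν => isClosed_cone hK ν.2) fun ν => ?_
  · refine eq_univ_of_forall fun x => ?_
    obtain ⟨ν, hν, hx⟩ := exists_mem_cone hK x
    exact mem_iUnion.2 ⟨⟨ν, hν⟩, hx⟩
  · exact (nodalGradientCLM W ν.1).continuous.continuousOn.congr fun x hx =>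
      h.eq_nodalGradient hK ν.2 hx

/-- The finitely many cones that do not contain `x` are closed, hence miss a neighbourhood of `x`. -/
theorem eventually_exists_mem_cone {n K : ℕ} (hK : 0 < K) (x : E n) :
    ∀ᶠ y in 𝓝 x, ∃ ν ∈ fanIndices n K, x ∈ cone ν ∧ y ∈ cone ν := by
  have hfin : {ν ∈ fanIndices n K | x ∉ cone ν}.Finite := (finite_fanIndices hK).subset
    fun ν h => h.1
  have h1 : ∀ᶠ y in 𝓝 x, ∀ ν ∈ {ν ∈ fanIndices n K | x ∉ cone ν}, y ∉ cone ν :=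
    (eventually_all_finite hfin).2 fun ν hν =>
      (isClosed_cone hK hν.1).isOpen_compl.mem_nhds hν.2
  filter_upwards [h1] with y hy
  obtain ⟨ν, hν, hyν⟩ := exists_mem_cone hK y
  exact ⟨ν, hν, by_contra fun hx => hy ν ⟨hν, hx⟩ hyν, hyν⟩

/-- Along a curve with right derivative `y` at `t`, the difference quotients of `V` are bounded by the
linear forms of those cones that contain the point `φ t`: nearby points share such a cone with it. -/
theorem IsConewiseInterpolation.eventually_slope_lt {n K : ℕ} (hK : 0 < K) {W V : E n → ℝ}
    (h : IsConewiseInterpolation K W V) {φ : ℝ → E n} {t : ℝ} {y : E n}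
    (hφ : HasDerivWithinAt φ y (Ici t) t) {r : ℝ}
    (hr : ∀ ν ∈ fanIndices n K, φ t ∈ cone ν → nodalGradient W ν y < r) :
    ∀ᶠ s in 𝓝[>] t, (V (φ s) - V (φ t)) / (s - t) < r := by
  have h1 : ∀ᶠ s in 𝓝[>] t, ∃ ν ∈ fanIndices n K, φ t ∈ cone ν ∧ φ s ∈ cone ν :=
    (hφ.Ioi_of_Ici.continuousWithinAt.tendsto).eventually (eventually_exists_mem_cone hK (φ t))
  have h2 : ∀ ν ∈ fanIndices n K, φ t ∈ cone ν → ∀ᶠ s in 𝓝[>] t,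
      nodalGradient W ν (slope φ t s) < r := by
    intro ν hν hx
    have hs : Tendsto (slope φ t) (𝓝[>] t) (𝓝 y) :=
      (hasDerivWithinAt_iff_tendsto_slope' self_notMem_Ioi).1 hφ.Ioi_of_Ici
    exact (((nodalGradientCLM W ν).continuous.tendsto y).comp hs).eventually_lt_const (hr ν hν hx)
  have h3 : ∀ᶠ s in 𝓝[>] t, ∀ ν ∈ {ν ∈ fanIndices n K | φ t ∈ cone ν},
      nodalGradient W ν (slope φ t s) < r :=
    (eventually_all_finite ((finite_fanIndices hK).subset fun ν h => h.1)).2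
      fun ν hν => h2 ν hν.1 hν.2
  filter_upwards [h1, h3] with s ⟨ν, hν, hx, hy⟩ hs
  have := hs ν ⟨hν, hx⟩
  rw [← nodalGradientCLM_apply, slope_def_module, map_smul, map_sub, smul_eq_mul] at this
  rw [h.eq_nodalGradient hK hν hx, h.eq_nodalGradient hK hν hy, div_eq_inv_mul]
  exact this

lemma linField_sum {n : ℕ} (A : Matrix (Fin n) (Fin n) ℝ) (c : Fin n → ℝ) (v : Fin n → E n) :
    linField A (∑ j, c j • v j) = ∑ j, c j • linField A (v j) := by
  have : ∀ x, linField A x = Matrix.toLpLin 2 2 A x := fun x => rfl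
  simp [this]

/-! ### Consequences of the constraints of the linear program -/

section Feasible

variable {n K : ℕ} {P : Type*} {A : P → Matrix (Fin n) (Fin n) ℝ} {aLo aHi μ α : ℝ}
  {W V : P → E n → ℝ}

lemma vertex_mem_vertices {ν : SimplexIndex n} (hν : ν ∈ fanIndices n K) (j : Fin n) :
    vertex ν j ∈ vertices n K := ⟨ν, hν, Or.inr ⟨j, rfl⟩⟩

lemma norm_sum_smul_vertex_le (ν : SimplexIndex n) {c : Fin n → ℝ} (hc : ∀ j, 0 ≤ c j) :
    ‖∑ j, c j • vertex ν j‖ ≤ ∑ j, c j * ‖vertex ν j‖ := by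
  refine (norm_sum_le _ _).trans (Finset.sum_le_sum fun j _ => ?_)
  rw [norm_smul, Real.norm_of_nonneg (hc j)]

/-- Linearity carries the decay constraint from the vertices to the cone. -/
lemma IsFeasible.nodalGradient_linField_le (hW : IsFeasible K A aLo aHi μ α W)
    {ν : SimplexIndex n} (hν : ν ∈ fanIndices n K) (i : P) {c : Fin n → ℝ} (hc : ∀ j, 0 ≤ c j) :
    nodalGradient (W i) ν (linField (A i) (∑ j, c j • vertex ν j)) ≤
      -α * ∑ j, c j * ‖vertex ν j‖ := by
  rw [linField_sum, ← nodalGradientCLM_apply, map_sum, Finset.mul_sum]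
  refine Finset.sum_le_sum fun j _ => ?_
  rw [map_smul, smul_eq_mul, nodalGradientCLM_apply]
  calc c j * nodalGradient (W i) ν (linField (A i) (vertex ν j))
      ≤ c j * (-α * ‖vertex ν j‖) := mul_le_mul_of_nonneg_left (hW.decay ν hν j i) (hc j)
    _ = -α * (c j * ‖vertex ν j‖) := by ring

lemma IsFeasible.nodalGradient_linField_le_norm (hα : 0 < α) (hW : IsFeasible K A aLo aHi μ α W)
    {ν : SimplexIndex n} (hν : ν ∈ fanIndices n K) (i : P) {x : E n} (hx : x ∈ cone ν) :
    nodalGradient (W i) ν (linField (A i) x) ≤ -α * ‖x‖ := by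
  obtain ⟨c, hc, rfl⟩ := hx
  refine (hW.nodalGradient_linField_le hν i hc).trans ?_
  rw [neg_mul, neg_mul, neg_le_neg_iff]
  exact mul_le_mul_of_nonneg_left (norm_sum_smul_vertex_le ν hc) hα.le

lemma IsFeasible.nodalGradient_linField_le_interp (haHi : 0 < aHi) (hα : 0 < α)
    (hW : IsFeasible K A aLo aHi μ α W) (hV : ∀ i, IsConewiseInterpolation K (W i) (V i))
    {ν : SimplexIndex n} (hν : ν ∈ fanIndices n K) (i : P) {x : E n} (hx : x ∈ cone ν) :
    nodalGradient (W i) ν (linField (A i) x) ≤ -(α / aHi) * V i x := by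
  obtain ⟨c, hc, rfl⟩ := hx
  refine (hW.nodalGradient_linField_le hν i hc).trans ?_
  rw [hV i ν hν c hc, neg_mul, neg_mul, neg_le_neg_iff]
  calc α / aHi * ∑ j, c j * W i (vertex ν j)
      ≤ α / aHi * ∑ j, c j * (aHi * ‖vertex ν j‖) := by
        refine mul_le_mul_of_nonneg_left (Finset.sum_le_sum fun j _ => ?_) (by positivity)
        exact mul_le_mul_of_nonneg_left (hW.upper i _ (vertex_mem_vertices hν j)) (hc j)
    _ = α * ∑ j, c j * ‖vertex ν j‖ := by
        simp only [Finset.mul_sum]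
        refine Finset.sum_congr rfl fun j _ => ?_
        field_simp

theorem IsFeasible.lower_interp (hK : 0 < K) (haLo : 0 < aLo) (hW : IsFeasible K A aLo aHi μ α W)
    (hV : ∀ i, IsConewiseInterpolation K (W i) (V i)) (i : P) (x : E n) :
    aLo * ‖x‖ ≤ V i x := by
  obtain ⟨ν, hν, c, hc, rfl⟩ := exists_mem_cone hK x
  rw [hV i ν hν c hc]
  calc aLo * ‖∑ j, c j • vertex ν j‖ ≤ aLo * ∑ j, c j * ‖vertex ν j‖ :=
        mul_le_mul_of_nonneg_left (norm_sum_smul_vertex_le ν hc) haLo.le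
    _ = ∑ j, c j * (aLo * ‖vertex ν j‖) := by
        rw [Finset.mul_sum]
        exact Finset.sum_congr rfl fun j _ => by ring
    _ ≤ _ := Finset.sum_le_sum fun j _ =>
        mul_le_mul_of_nonneg_left (hW.lower i _ (vertex_mem_vertices hν j)) (hc j)

/-- The bound is uniform in `i` because it comes from the interpolation of the norm itself, which is
linear on each of finitely many cones. -/
theorem IsFeasible.exists_upper_interp (hK : 0 < K) (haHi : 0 < aHi)
    (hW : IsFeasible K A aLo aHi μ α W)
    (hV : ∀ i, IsConewiseInterpolation K (W i) (V i)) :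
    ∃ a, aLo ≤ a ∧ ∀ i x, V i x ≤ a * ‖x‖ := by
  -- on each cone the interpolation of the norm is one of these linear forms
  set C := ∑ ν ∈ (finite_fanIndices (n := n) hK).toFinset, ‖nodalGradientCLM norm ν‖
  refine ⟨max aLo (aHi * C), le_max_left _ _, fun i x => ?_⟩
  obtain ⟨ν, hν, c, hc, hx⟩ := exists_mem_cone hK x
  calc V i x = ∑ j, c j * W i (vertex ν j) := by rw [hx, hV i ν hν c hc]
    _ ≤ ∑ j, c j * (aHi * ‖vertex ν j‖) := Finset.sum_le_sum fun j _ =>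
        mul_le_mul_of_nonneg_left (hW.upper i _ (vertex_mem_vertices hν j)) (hc j)
    _ = aHi * nodalGradientCLM norm ν x := by
        rw [nodalGradientCLM_apply, hx, nodalGradient_sum hK norm hν, Finset.mul_sum]
        exact Finset.sum_congr rfl fun j _ => by ring
    _ ≤ aHi * (‖nodalGradientCLM norm ν‖ * ‖x‖) :=
        mul_le_mul_of_nonneg_left ((le_abs_self _).trans ((nodalGradientCLM norm ν).le_opNorm x))
          haHi.le
    _ ≤ aHi * (C * ‖x‖) := by
        gcongr
        exact Finset.single_le_sum (f := fun ν => ‖nodalGradientCLM (norm : E n → ℝ) ν‖)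
          (fun _ _ => norm_nonneg _) ((finite_fanIndices hK).mem_toFinset.2 hν)
    _ = (aHi * C) * ‖x‖ := by ring
    _ ≤ _ := mul_le_mul_of_nonneg_right (le_max_right _ _) (norm_nonneg _)

theorem IsFeasible.jump_interp (hK : 0 < K) (hW : IsFeasible K A aLo aHi μ α W)
    (hV : ∀ i, IsConewiseInterpolation K (W i) (V i)) (i j : P) (x : E n) :
    V i x ≤ μ * V j x := by
  obtain ⟨ν, hν, c, hc, rfl⟩ := exists_mem_cone hK x
  rw [hV i ν hν c hc, hV j ν hν c hc, Finset.mul_sum]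
  refine Finset.sum_le_sum fun k _ => ?_
  calc c k * W i (vertex ν k) ≤ c k * (μ * W j (vertex ν k)) :=
        mul_le_mul_of_nonneg_left (hW.jump j i _ (vertex_mem_vertices hν k)) (hc k)
    _ = _ := by ring

end Feasible

/-! ### Carathéodory solutions and decay along them -/

lemma continuous_linField {n : ℕ} (A : Matrix (Fin n) (Fin n) ℝ) : Continuous (linField A) :=
  (Matrix.toLpLin 2 2 A).continuous_of_finiteDimensional

/-- An absolutely continuous solution of an autonomous equation with continuous right-hand side is a
classical one: it differs by a constant from the integral of the right-hand side. -/
theorem hasDerivWithinAt_Ici_of_ae_hasDerivAt {F : Type*} [NormedAddCommGroup F] [NormedSpace ℝ F]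
    [CompleteSpace F] {f : F → F} (hf : Continuous f) {x : ℝ → F} {a b : ℝ}
    (hx : AbsolutelyContinuousOnInterval x a b)
    (hae : ∀ᵐ t, t ∈ Ioo a b → HasDerivAt x (f (x t)) t) {t : ℝ} (ht : t ∈ Ico a b) :
    HasDerivWithinAt x (f (x t)) (Ici t) t := by
  have hab : a ≤ b := ht.1.trans ht.2.le
  -- `x` is continuous on `[a, b]` only; a continuous extension makes the integral smooth everywhere
  set y : ℝ → F := IccExtend hab ((Icc a b).domRestrict x) with hy
  have hyc : Continuous y := by
    have := hx.continuousOn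
    rw [uIcc_of_le hab] at this
    exact this.domRestrict.Icc_extend'
  have hyx : ∀ s ∈ Icc a b, y s = x s := fun s hs => by rw [hy, IccExtend_of_mem _ _ hs]; rfl
  set G : ℝ → F := fun s => ∫ r in a..s, f (y r) with hG
  have hGd : ∀ s, HasDerivAt G (f (y s)) s := fun s =>
    ((hf.comp hyc).integral_hasStrictDerivAt a s).hasDerivAt
  have hGc : ContDiff ℝ 1 G := by
    rw [contDiff_one_iff_deriv]
    refine ⟨fun s => (hGd s).differentiableAt, ?_⟩
    rw [show deriv G = fun s => f (y s) from funext fun s => (hGd s).deriv]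
    exact hf.comp hyc
  have hsub : AbsolutelyContinuousOnInterval (x - G) a b :=
    hx.sub hGc.contDiffOn.absolutelyContinuousOnInterval
  obtain ⟨C, hC⟩ := hsub.const_of_ae_hasDerivAt_zero <| by
    filter_upwards [hae, measure_eq_zero_iff_ae_notMem.1 (measure_singleton a),
      measure_eq_zero_iff_ae_notMem.1 (measure_singleton b)]
      with s hs hsa hsb hsab
    rw [uIcc_of_le hab] at hsab
    have h1 : s ∈ Ioo a b := ⟨lt_of_le_of_ne hsab.1 (Ne.symm hsa), lt_of_le_of_ne hsab.2 hsb⟩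
    have := (hs h1).sub (hGd s)
    rwa [hyx s hsab, sub_self] at this
  rw [uIcc_of_le hab] at hC
  have hxG : ∀ s ∈ Icc a b, x s = C + G s := fun s hs => by
    rw [← hC s hs, Pi.sub_apply, sub_add_cancel]
  have h1 := ((hGd t).const_add C).hasDerivWithinAt (s := Ici t)
  rw [hyx t ⟨ht.1, ht.2.le⟩] at h1
  refine h1.congr_of_eventuallyEq ?_ (hxG t ⟨ht.1, ht.2.le⟩)
  filter_upwards [Icc_mem_nhdsGE ht.2] with s hs
  exact hxG s ⟨ht.1.trans hs.1, hs.2⟩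

lemma IsSolution.hasDerivWithinAt {n : ℕ} {f : ℝ → E n → E n} {g : E n → E n}
    (hg : Continuous g) {x : ℝ → E n} (hx : IsSolution f x) {a b : ℝ} (ha : 0 ≤ a)
    (hfg : ∀ t ∈ Ico a b, f t = g) {t : ℝ} (ht : t ∈ Ico a b) :
    HasDerivWithinAt x (g (x t)) (Ici t) t := by
  have hab : a ≤ b := ht.1.trans ht.2.le
  refine hasDerivWithinAt_Ici_of_ae_hasDerivAt hg ((hx.1 b (ha.trans hab)).mono ?_) ?_ ht
  · rw [uIcc_of_le hab, uIcc_of_le (ha.trans hab)]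
    exact Icc_subset_Icc_left ha
  · filter_upwards [(ae_restrict_iff' measurableSet_Ici).1 hx.2] with s hs hsab
    have := hs (ha.trans hsab.1.le)
    rwa [hfg s ⟨hsab.1.le, hsab.2⟩] at this

theorem IsConewiseInterpolation.diniLE {n K : ℕ} (hK : 0 < K) {W V : E n → ℝ}
    (h : IsConewiseInterpolation K W V) {f : E n → E n} (hf : Continuous f) {x : E n} {r : ℝ}
    (hr : ∀ ν ∈ fanIndices n K, x ∈ cone ν → nodalGradient W ν (f x) ≤ r) :
    DiniLE V f x r := by
  rintro φ rfl hφ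
  have hd := hφ.hasDerivWithinAt hf le_rfl (fun _ _ => rfl) (left_mem_Ico.2 one_pos)
  rw [diniAlong, ← EReal.le_of_forall_lt_iff_le]
  intro r' hr'
  refine limsup_le_of_le (by isBoundedDefault) ?_
  filter_upwards [h.eventually_slope_lt hK hd
    fun ν hν hx => (hr ν hν hx).trans_lt (EReal.coe_lt_coe_iff.1 hr')] with s hs
  rw [sub_zero] at hs
  exact EReal.coe_le_coe_iff.2 hs.le

theorem IsConewiseInterpolation.le_exp_mul {n K : ℕ} (hK : 0 < K) {W V : E n → ℝ}
    (h : IsConewiseInterpolation K W V) {f : ℝ → E n → E n} {g : E n → E n} (hg : Continuous g)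
    {β : ℝ}
    (hβ : ∀ ν ∈ fanIndices n K, ∀ x ∈ cone ν, nodalGradient W ν (g x) ≤ -β * V x)
    {x : ℝ → E n} (hx : IsSolution f x) {a b : ℝ} (ha : 0 ≤ a) (hab : a ≤ b)
    (hfg : ∀ t ∈ Ico a b, f t = g) :
    V (x b) ≤ Real.exp (-β * (b - a)) * V (x a) := by
  have hc : ContinuousOn (fun t => V (x t)) (Icc a b) := by
    refine (h.continuous hK).comp_continuousOn ?_
    have := (hx.1 b (ha.trans hab)).continuousOn
    rw [uIcc_of_le (ha.trans hab)] at this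
    exact this.mono (Icc_subset_Icc_left ha)
  have := le_gronwallBound_of_liminf_deriv_right_le (f' := fun t => -β * V (x t)) (δ := V (x a))
    (K := -β) (ε := 0) hc ?_ le_rfl (fun t _ => by simp) b (right_mem_Icc.2 hab)
  · rwa [gronwallBound_ε0, mul_comm] at this
  · intro t ht r hr
    refine Eventually.frequently ?_
    filter_upwards [h.eventually_slope_lt hK (hx.hasDerivWithinAt hg ha hfg ht)
      fun ν hν hxν => (hβ ν hν _ hxν).trans_lt hr] with s hs
    rwa [div_eq_inv_mul] at hs

/-! ### Average dwell-time -/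

/-- A switching signal is constant up to the next switch: there it is continuous for the discrete
topology. -/
lemma IsSwitchingSignal.eq_of_mem_Ico {P : Type*} {σ : ℝ → P} (hσ : IsSwitchingSignal σ) {s t : ℝ}
    (hs : 0 ≤ s) (hno : switchTimes σ ∩ Ioo s t = ∅) {u : ℝ} (hu : u ∈ Ico s t) : σ u = σ s := by
  let : TopologicalSpace P := ⊥
  have : DiscreteTopology P := ⟨rfl⟩
  have hc : ContinuousOn σ (Ico s t) := by
    intro v hv
    have hev : ∀ᶠ w in 𝓝[Ico s t] v, σ w = σ v := by
      rcases hv.1.eq_or_lt with rfl | h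
      · exact (hσ.1 s hs).filter_mono (nhdsWithin_mono _ fun w hw => hw.1)
      · have : v ∉ switchTimes σ := fun hv' => by
          have : v ∈ switchTimes σ ∩ Ioo s t := ⟨hv', h, hv.2⟩
          rw [hno] at this
          exact this
        have h2 : ∀ᶠ w in 𝓝 v, σ w = σ v := by
          by_contra h3
          exact this ⟨hs.trans_lt h, h3⟩
        exact h2.filter_mono nhdsWithin_le_nhds
    exact tendsto_const_nhds.congr' (hev.mono fun w hw => hw.symm)
  exact isPreconnected_Ico.constant hc hu (left_mem_Ico.2 (hu.1.trans_lt hu.2))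

/-- Decay between switches and a factor `μ` per switch. The conclusion is about some mode `i`, the one
active just before `t`, since a switch at `t` itself is not counted. -/
theorem IsSwitchingSignal.exists_le_pow_mul_exp {n : ℕ} {P : Type*} {σ : ℝ → P}
    (hσ : IsSwitchingSignal σ) {V : P → E n → ℝ} {x : ℝ → E n} {β μ : ℝ} (hμ : 1 ≤ μ)
    (hjump : ∀ i j y, V i y ≤ μ * V j y)
    (hdecay : ∀ i a b, 0 ≤ a → a ≤ b → (∀ t ∈ Ico a b, σ t = i) →
      V i (x b) ≤ Real.exp (-β * (b - a)) * V i (x a)) (N : ℕ) :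
    ∀ s t, 0 ≤ s → s ≤ t → (switchTimes σ ∩ Ioo s t).ncard = N →
      ∃ i, V i (x t) ≤ μ ^ N * Real.exp (-β * (t - s)) * V (σ s) (x s) := by
  induction N with
  | zero =>
    intro s t hs hst hN
    have hfin : (switchTimes σ ∩ Ioo s t).Finite :=
      (hσ.2 t).subset fun u hu => ⟨hu.1, hu.2.2.le⟩
    refine ⟨σ s, ?_⟩
    rw [pow_zero, one_mul]
    exact hdecay _ s t hs hst fun u hu => hσ.eq_of_mem_Ico hs ((ncard_eq_zero hfin).1 hN) hu
  | succ N ih =>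
    intro s t hs hst hN
    have hfin : (switchTimes σ ∩ Ioo s t).Finite :=
      (hσ.2 t).subset fun u hu => ⟨hu.1, hu.2.2.le⟩
    have hne : (switchTimes σ ∩ Ioo s t).Nonempty := nonempty_of_ncard_ne_zero (by omega)
    -- the first switch in `(s, t)`
    obtain ⟨p, ⟨hpσ, hsp, hpt⟩, hmin⟩ := exists_min_image _ id hfin hne
    have hins : switchTimes σ ∩ Ioo s t = insert p (switchTimes σ ∩ Ioo p t) := by
      ext u
      constructor
      · intro hu
        rcases (hmin u hu).eq_or_lt with h | h
        · exact Or.inl h.symm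
        · exact Or.inr ⟨hu.1, h, hu.2.2⟩
      · rintro (rfl | hu)
        · exact ⟨hpσ, hsp, hpt⟩
        · exact ⟨hu.1, hsp.trans hu.2.1, hu.2.2⟩
    have hN' : (switchTimes σ ∩ Ioo p t).ncard = N := by
      rw [hins, ncard_insert_of_notMem (fun h => lt_irrefl p h.2.1)
        (hfin.subset (hins ▸ subset_insert _ _))] at hN
      omega
    obtain ⟨i, hi⟩ := ih p t (hs.trans hsp.le) hpt.le hN'
    have hno : switchTimes σ ∩ Ioo s p = ∅ := by
      refine eq_empty_of_forall_notMem fun u hu => ?_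
      exact absurd (hmin u ⟨hu.1, hu.2.1, hu.2.2.trans hpt⟩) (not_le.2 hu.2.2)
    have h1 := hdecay (σ s) s p hs hsp.le fun u hu => hσ.eq_of_mem_Ico hs hno hu
    refine ⟨i, hi.trans ?_⟩
    have hμ0 : 0 < μ := by linarith
    calc μ ^ N * Real.exp (-β * (t - p)) * V (σ p) (x p)
        ≤ μ ^ N * Real.exp (-β * (t - p)) *
          (μ * (Real.exp (-β * (p - s)) * V (σ s) (x s))) := by
          refine mul_le_mul_of_nonneg_left ((hjump _ (σ s) _).trans ?_) (by positivity)
          exact mul_le_mul_of_nonneg_left h1 hμ0.le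
      _ = μ ^ (N + 1) * Real.exp (-β * (t - s)) * V (σ s) (x s) := by
          rw [show -β * (t - s) = -β * (t - p) + -β * (p - s) by ring, Real.exp_add]
          ring

/-- The rate is `β - log μ / τ`: under average dwell-time, `(s, t)` has at most `N₀ + (t - s) / τ`
switches, which cost a factor `exp ((N₀ + (t - s) / τ) log μ)`. -/
theorem isGESUnderDwellTime_of_decay {n : ℕ} {P : Type*} {f : P → E n → E n} {V : P → E n → ℝ}
    {aLo aHi β μ τ : ℝ} (haLo : 0 < aLo) (haHi : 0 < aHi) (hβ : 0 < β) (hμ : 1 ≤ μ)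
    (hlower : ∀ i y, aLo * ‖y‖ ≤ V i y) (hupper : ∀ i y, V i y ≤ aHi * ‖y‖)
    (hjump : ∀ i j y, V i y ≤ μ * V j y)
    (hdecay : ∀ σ : ℝ → P, ∀ x : ℝ → E n, IsSolution (fun t => f (σ t)) x → ∀ i a b, 0 ≤ a →
      a ≤ b → (∀ t ∈ Ico a b, σ t = i) → V i (x b) ≤ Real.exp (-β * (b - a)) * V i (x a))
    (hτ : Real.log μ / β < τ) : IsGESUnderDwellTime f τ := by
  have hlog : 0 ≤ Real.log μ := Real.log_nonneg hμ
  have hτ0 : 0 < τ := (div_nonneg hlog hβ.le).trans_lt hτ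
  have hμ0 : 0 < μ := by linarith
  refine ⟨β - Real.log μ / τ, ?_, fun N₀ _ => ⟨aHi / aLo * Real.exp (N₀ * Real.log μ),
    by positivity, fun σ hσ hdwell x hx s t hs hst => ?_⟩⟩
  · rw [sub_pos, div_lt_iff₀ hτ0]
    rwa [div_lt_iff₀ hβ, mul_comm] at hτ
  obtain ⟨i, hi⟩ := hσ.exists_le_pow_mul_exp hμ hjump (hdecay σ x hx) _ s t hs hst rfl
  set N := (switchTimes σ ∩ Ioo s t).ncard
  have hpow : μ ^ N ≤ Real.exp ((N₀ + (t - s) / τ) * Real.log μ) := by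
    rw [← Real.exp_log (pow_pos hμ0 N), Real.log_pow]
    gcongr
    exact hdwell s t hs hst
  have hexp : Real.exp ((N₀ + (t - s) / τ) * Real.log μ) * Real.exp (-β * (t - s)) =
      Real.exp (N₀ * Real.log μ) * Real.exp (-(β - Real.log μ / τ) * (t - s)) := by
    rw [← Real.exp_add, ← Real.exp_add]
    congr 1
    ring
  calc ‖x t‖ ≤ V i (x t) / aLo := by
        rw [le_div_iff₀ haLo, mul_comm]
        exact hlower i _
    _ ≤ (Real.exp ((N₀ + (t - s) / τ) * Real.log μ) * Real.exp (-β * (t - s)) *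
          (aHi * ‖x s‖)) / aLo := by
        gcongr
        refine hi.trans ((mul_le_mul_of_nonneg_left (hupper _ _) (by positivity)).trans ?_)
        gcongr
    _ = _ := by
        rw [hexp]
        ring

end FanLP

theorem mainTheorem2 {n K : ℕ} (hK : 0 < K) {P : Type*}
    (A : P → Matrix (Fin n) (Fin n) ℝ) {aLo aHi μ α : ℝ}
    (haLo : 0 < aLo) (haHi : 0 < aHi) (hμ : 1 ≤ μ) (hα : 0 < α)
    (W : P → FanLP.E n → ℝ) (hW : FanLP.IsFeasible K A aLo aHi μ α W) :
    -- the simplices are nondegenerate and the cones they span cover the space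
    (∀ ν ∈ FanLP.fanIndices n K, LinearIndependent ℝ (FanLP.vertex ν)) ∧
    (∀ x : FanLP.E n, ∃ ν ∈ FanLP.fanIndices n K, x ∈ FanLP.cone ν) ∧
    ∃ V : P → FanLP.E n → ℝ,
      -- the conewise linear interpolation is well defined, continuous and piecewise linear
      (∀ i, FanLP.IsConewiseInterpolation K (W i) (V i)) ∧
      (∀ i, ∀ V' : FanLP.E n → ℝ, FanLP.IsConewiseInterpolation K (W i) V' → V' = V i) ∧
      (∀ i, Continuous (V i)) ∧
      (∀ i, ∀ ν ∈ FanLP.fanIndices n K, ∀ x ∈ FanLP.cone ν,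
        V i x = FanLP.nodalGradient (W i) ν x) ∧
      -- it satisfies the multiple-Lyapunov-function conditions of degree one
      (∃ aHi' : ℝ,
        FanLP.LyapunovConditions (fun i => FanLP.linField (A i)) V 1 aLo aHi' α μ) ∧
      -- it decays along each subsystem with the better rate
      (∀ i x, FanLP.DiniLE (V i) (FanLP.linField (A i)) x (-(α / aHi) * V i x)) ∧
      -- average dwell-time bound
      ∀ τ : ℝ, aHi * Real.log μ / α < τ →
        FanLP.IsGESUnderDwellTime (fun i => FanLP.linField (A i)) τ := by
  have hV : ∀ i, FanLP.IsConewiseInterpolation K (W i) (FanLP.fanInterp K (W i)) :=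
    fun i => FanLP.isConewiseInterpolation_fanInterp hK (W i)
  obtain ⟨aHi', hle, hupper⟩ := hW.exists_upper_interp hK haHi hV
  refine ⟨fun ν hν => FanLP.linearIndependent_vertex hK hν, FanLP.exists_mem_cone hK,
    fun i => FanLP.fanInterp K (W i), hV, fun i V' hV' => (hV i).unique hK hV',
    fun i => (hV i).continuous hK, fun i ν hν x hx => (hV i).eq_nodalGradient hK hν hx,
    ⟨aHi', ?_⟩, fun i x => ?_, fun τ hτ => ?_⟩
  · exact
      { d_pos := one_pos
        aLo_pos := haLo
        aLo_le := hle
        α_pos := hα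
        one_le_μ := hμ
        cont := fun i => (hV i).continuous hK
        lower := fun i x => by
          rw [Real.rpow_one]
          exact hW.lower_interp hK haLo hV i x
        upper := fun i x => by
          rw [Real.rpow_one]
          exact hupper i x
        decay := fun i x => by
          rw [Real.rpow_one]
          exact (hV i).diniLE hK (FanLP.continuous_linField _) fun ν hν hx =>
            hW.nodalGradient_linField_le_norm hα hν i hx
        jump := fun i j _ x => hW.jump_interp hK hV i j x }
  · exact (hV i).diniLE hK (FanLP.continuous_linField _) fun ν hν hx =>
      hW.nodalGradient_linField_le_interp haHi hα hV hν i hx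
  · refine FanLP.isGESUnderDwellTime_of_decay haLo (haLo.trans_le hle) (div_pos hα haHi) hμ
      (hW.lower_interp hK haLo hV) hupper (hW.jump_interp hK hV) ?_ ?_
    · intro σ x hx i a b ha hab hσ
      exact (hV i).le_exp_mul hK (FanLP.continuous_linField (A i))
        (fun ν hν y hy => hW.nodalGradient_linField_le_interp haHi hα hV hν i hy) hx ha hab
        fun t ht => by rw [hσ t ht]
    · rwa [div_div_eq_mul_div, mul_comm]
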